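/- **Theorem (Metropolis-corrected PDMP).** *Setting.* Let $(E,\lambda_E)$, $(V,\lambda_V)$, $(V^r,\lambda_{V^r})$ be measurable spaces with $\sigma$-finite measures, let $T>0$, and let $\mu\ge 0$ be a probability density on $E$ with respect to $\lambda_E$ (also write $\mu$ for the measure $\mu\,d\lambda_E$). Consider a PDMP on $E$ with measurable flow $(\Phi_t)_{t\in\mathbb R}$ ($\Phi_0=\mathrm{id}$, $\Phi_{s+t}=\Phi_s\circ\Phi_t$), event rate $\lambda\ge 0$, and jump kernel $Q(\cdot|x)$ equal to the image of the probability measure $\nu_x\,d\lambda_V$ under an injection $\xi_x:V\to E$; and a backward PDMP with flow $\Phi_{-t}$, event rate $\lambda^r$ and jump kernel $Q^r(\cdot|x)$ parametrised in the same way by $\xi^r_x:V^r\to E$ and densities $\nu^r_x$. All these maps are jointly measurable and the rates are locally integrable along the flows. The path spaces are $$W=E\times\bigcup_{k\ge0}\{(\tau_i,v_i)_{i\le k}\in((0,T)\times V)^k:\ \tau_1<\dots<\tau_k\}$$ and $W^r$ (the same with $V^r$), with the product measures $\lambda_W,\lambda_{W^r}$ (Lebesgue measure for the times). For $w=(z_0,(\tau_i,v_i)_i)\in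 W$ put $\tau_0=0$, $z_i=\xi_{x_i}(v_i)$ with $x_i=\Phi_{\tau_i-\tau_{i-1}}(z_{i-1})$ the state just before the $i$-th event, $w_0=z_0$, and $w_T=\Phi_{T-\tau_k}(z_k)$; similarly on $W^r$ with the backward characteristics. *Approximate processes.* Let $\tilde\lambda_z(t)\ge0$ be jointly measurable and locally integrable in $t\ge 0$. The approximate forward process started from $z_0$ is simulated as follows: after the $i$-th event (or at time $0$, with $i=0$), in state $z_i$, the waiting time to the next event is the first event time of a Poisson process with rate $t\mapsto\tilde\lambda_{z_i}(t)$, the state follows the flow until then, and the mark $v_{i+1}$ is drawn from $\nu_{x_{i+1}}\,d\lambda_V$; this is stopped at time $T$. Let $$\tilde p(w|z_0)=e^{-\int_0^{T-\tau_k}\tilde\lambda_{z_k}(t)dt}\prod_{i=1}^k\tilde\lambda_{z_{i-1}}(\tau_i-\tau_{i-1})\,e^{-\int_0^{\tau_i-\tau_{i-1}}\tilde\lambda_{z_{i-1}}(t)dt}\,\nu_{x_i}(v_i).$$ The approximate backward process and $\tilde p^r$ are defined likewise from a rate $\tilde\lambda^r_z(t)$ and the backward characteristics. Assume that, from every initial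 state, both approximate processes almost surely have finitely many events before $T$. *Reversal.* Assume that reversing paths defines a bimeasurable bijection $R:W\to W^r$: $R(w)$ starts at $w_T$, has events at the times $T-\tau_k<\dots<T-\tau_1$, and its state just after the event at $T-\tau_i$ is $x_i$. Assume that there is a measurable $\psi:W^r\to[0,\infty)$ with $\int_W f(R(w))\,\lambda_W(dw)=\int_{W^r}f\,\psi\,d\lambda_{W^r}$ for all measurable $f\ge0$. *Kernel.* The Metropolis-adjusted PDMP kernel on $E\times\{-1,1\}$ does the following from $(z_0,\gamma)$. If $\gamma=1$, sample an approximate forward path $w$ from $z_0$ and set $$\alpha(w)=1\wedge\frac{\mu(w_T)\,\tilde p^r(R(w)|w_T)}{\mu(z_0)\,\tilde p(w|z_0)\,\psi(R(w))}.$$ If $\gamma=-1$, sample an approximate backward path $w$ from $z_0$ and set $$\alpha^r(w)=1\wedge\frac{\mu(w_T)\,\tilde p(R^{-1}(w)|w_T)\,\psi(w)}{\mu(z_0)\,\tilde p^r(w|z_0)}.$$ With this probability move to $(w_T,-\gamma)$, otherwise stay at $(z_0,\gamma)$. (The convention for $0/0$ is immaterial; it is $0/0=0$, and $a/0=\infty$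 for $a>0$.) *Conclusion.* 1. This is a Markov kernel, and it satisfies detailed balance with respect to $\mu\otimes\mathrm{Uniform}\{-1,1\}$. 2. Suppose that the approximate processes are the exact ones, i.e. $\tilde\lambda_z(t)=\lambda(\Phi_t(z))$ and $\tilde\lambda^r_z(t)=\lambda^r(\Phi_{-t}(z))$ for all $z\in E$, $t\in[0,T]$, and that the backward PDMP is the time reversal on $[0,T]$ of the PDMP started from $\mu$: if $w$ is the path of the exact PDMP with initial law $\mu$, then $R(w)$ has the law of the path of the backward PDMP with initial law $\mu$. Then the acceptance probability is $1$: $\alpha=1$ almost surely for the forward path with initial law $\mu$, and $\alpha^r=1$ almost surely for the backward path with initial law $\mu$. -/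

import Mathlib

open MeasureTheory ProbabilityTheory
open scoped ENNReal NNReal

noncomputable section

namespace PDMPSampler

/-! ### Skeletons and path spaces -/

section PathSpace

/-- A skeleton on `(0, T)` with marks in `V`: finitely many events `(τ₁, v₁), …, (τ_k, v_k)`
with `0 < τ₁ < ⋯ < τ_k < T`. -/
def IsSkeleton {V : Type*} (T : ℝ) (s : Σ k : ℕ, (Fin k → ℝ × V)) : Prop :=
  (∀ i, (s.2 i).1 ∈ Set.Ioo 0 T) ∧ ∀ i j, i < j → (s.2 i).1 < (s.2 j).1

/-- The disjoint union over `k` of the sets of skeletons with `k` events. -/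
abbrev Skeleton (V : Type*) (T : ℝ) := {s : Σ k : ℕ, (Fin k → ℝ × V) // IsSkeleton T s}

/-- The path space `E × ⋃ₖ ((0, T) × V)ᵏ`: an initial state and a skeleton. -/
abbrev PathSpace (E V : Type*) (T : ℝ) := E × Skeleton V T

variable {E V : Type*} [MeasurableSpace E] [MeasurableSpace V]

/-- The inclusion of the sequences of `k` events into the disjoint union over all `k`. -/
def ofEvents {V : Type*} (k : ℕ) (e : Fin k → ℝ × V) : Σ k : ℕ, (Fin k → ℝ × V) := ⟨k, e⟩

theorem measurable_ofEvents (k : ℕ) : Measurable (ofEvents (V := V) k) :=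
  fun _ hs => (MeasurableSpace.measurableSet_iInf.1 hs) k

theorem ofEvents_injective {V : Type*} (k : ℕ) : Function.Injective (ofEvents (V := V) k) :=
  fun _ _ h => by simpa [ofEvents] using h

theorem measurableSet_sigma {s : Set (Σ k : ℕ, (Fin k → ℝ × V))}
    (h : ∀ k, MeasurableSet (ofEvents k ⁻¹' s)) : MeasurableSet s :=
  MeasurableSpace.measurableSet_iInf.2 h

theorem measurableEmbedding_ofEvents (k : ℕ) : MeasurableEmbedding (ofEvents (V := V) k) where
  injective := ofEvents_injective k
  measurable := measurable_ofEvents k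
  measurableSet_image' := fun s hs => by
    refine measurableSet_sigma fun j => ?_
    by_cases hj : j = k
    · subst hj
      rwa [Set.preimage_image_eq _ (ofEvents_injective j)]
    · have : ofEvents j ⁻¹' (ofEvents k '' s) = ∅ := by
        ext e
        simp only [Set.mem_preimage, Set.mem_image, Set.mem_empty_iff_false, iff_false]
        rintro ⟨e', -, h⟩
        exact hj (congrArg Sigma.fst h).symm
      rw [this]
      exact MeasurableSet.empty

theorem measurableSet_isSkeleton (T : ℝ) :
    MeasurableSet {s : Σ k : ℕ, (Fin k → ℝ × V) | IsSkeleton T s} := by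
  refine measurableSet_sigma fun k => ?_
  have : (ofEvents k ⁻¹' {s : Σ k : ℕ, (Fin k → ℝ × V) | IsSkeleton T s})
      = (⋂ i : Fin k, {e : Fin k → ℝ × V | (e i).1 ∈ Set.Ioo 0 T}) ∩
        ⋂ i : Fin k, ⋂ j : Fin k, ⋂ _ : i < j, {e : Fin k → ℝ × V | (e i).1 < (e j).1} := by
    ext e
    simp only [IsSkeleton, ofEvents, Set.mem_preimage, Set.mem_ofPred_eq, Set.mem_inter_iff,
      Set.mem_iInter]
  rw [this]
  refine (MeasurableSet.iInter fun i => ?_).inter (MeasurableSet.iInter fun i =>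
    MeasurableSet.iInter fun j => MeasurableSet.iInter fun _ => ?_)
  · exact (measurable_fst.comp (measurable_pi_apply i)) measurableSet_Ioo
  · exact measurableSet_lt (measurable_fst.comp (measurable_pi_apply i))
      (measurable_fst.comp (measurable_pi_apply j))

theorem measurableEmbedding_skeleton (T : ℝ) :
    MeasurableEmbedding (Subtype.val : Skeleton V T → Σ k : ℕ, (Fin k → ℝ × V)) :=
  MeasurableEmbedding.subtype_coe (measurableSet_isSkeleton T)

/-- The canonical measure on skeletons: on skeletons with `k` events, the restriction of the
`k`-fold power of `Lebesgue ⊗ λ_V`. -/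
def skeletonMeasure (lamV : Measure V) (T : ℝ) : Measure (Skeleton V T) :=
  (Measure.sum fun k : ℕ =>
    (Measure.pi fun _ : Fin k => (volume : Measure ℝ).prod lamV).map (ofEvents k)).comap
      Subtype.val

/-- The canonical measure `λ_W` on the path space. -/
def pathMeasure (lamE : Measure E) (lamV : Measure V) (T : ℝ) : Measure (PathSpace E V T) :=
  lamE.prod (skeletonMeasure lamV T)

end PathSpace

/-! ### Piecewise-deterministic Markov processes and approximate event rates -/

/-- The characteristics of a PDMP on `E`: a deterministic flow, an event rate `lam`, and a jump
kernel given in parametrised form, `Q(· | x)` being the image under the injection `xi x : V → E`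
of the probability measure with density `nu x` with respect to `lamV`. -/
structure PDMP (E V : Type*) [MeasurableSpace E] [MeasurableSpace V] (lamV : Measure V) where
  flow : ℝ → E → E
  measurable_flow : Measurable (Function.uncurry flow)
  flow_zero : ∀ z, flow 0 z = z
  flow_add : ∀ s t z, flow (s + t) z = flow s (flow t z)
  lam : E → ℝ≥0
  measurable_lam : Measurable lam
  lam_locally_integrable : ∀ z t, ∫⁻ u in Set.Ioc 0 t, (lam (flow u z) : ℝ≥0∞) < ∞
  xi : E → V → E
  measurable_xi : Measurable (Function.uncurry xi)
  xi_injective : ∀ x, Function.Injective (xi x)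
  nu : E → V → ℝ≥0
  measurable_nu : Measurable (Function.uncurry nu)
  lintegral_nu : ∀ x, ∫⁻ v, (nu x v : ℝ≥0∞) ∂lamV = 1

/-- An event rate in use between two consecutive events: `toFun z t` is the event rate at time
`t` after the last event (or after time `0`), where `z` is the state just after that event. -/
structure EventRate (E : Type*) [MeasurableSpace E] where
  toFun : E → ℝ → ℝ≥0
  measurable_toFun : Measurable (Function.uncurry toFun)
  locally_integrable : ∀ z t, ∫⁻ u in Set.Ioc 0 t, (toFun z u : ℝ≥0∞) < ∞

namespace EventRate

variable {E : Type*} [MeasurableSpace E] (r : EventRate E)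

/-- `exp (-∫₀ᵗ r z u du)`, the probability that a Poisson process with rate `u ↦ r z u` has no
event before time `t`. -/
def survival (z : E) (t : ℝ) : ℝ≥0 :=
  Real.toNNReal (Real.exp (-(∫⁻ u in Set.Ioc 0 t, (r.toFun z u : ℝ≥0∞)).toReal))

theorem measurable_survival : Measurable (Function.uncurry r.survival) := by
  have h : Measurable fun p : E × ℝ =>
      ∫⁻ u, (Set.Ioc 0 p.2).indicator (fun u => (r.toFun p.1 u : ℝ≥0∞)) u := by
    refine Measurable.lintegral_prod_right' (f := fun q : (E × ℝ) × ℝ =>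
      (Set.Ioc 0 q.1.2).indicator (fun u => (r.toFun q.1.1 u : ℝ≥0∞)) q.2) ?_
    have hset : MeasurableSet {q : (E × ℝ) × ℝ | 0 < q.2 ∧ q.2 ≤ q.1.2} :=
      (measurableSet_lt measurable_const measurable_snd).inter
        (measurableSet_le measurable_snd (measurable_snd.comp measurable_fst))
    have hf : Measurable fun q : (E × ℝ) × ℝ => (r.toFun q.1.1 q.2 : ℝ≥0∞) :=
      (r.measurable_toFun.comp ((measurable_fst.comp measurable_fst).prodMk
        measurable_snd)).coe_nnreal_ennreal
    exact hf.indicator hset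
  have h' : Function.uncurry r.survival = fun p : E × ℝ =>
      Real.toNNReal (Real.exp (-(∫⁻ u, (Set.Ioc 0 p.2).indicator
        (fun u => (r.toFun p.1 u : ℝ≥0∞)) u).toReal)) := by
    funext p
    simp only [Function.uncurry, survival, lintegral_indicator measurableSet_Ioc]
  rw [h']
  exact (Real.measurable_exp.comp h.ennreal_toReal.neg).real_toNNReal

end EventRate

namespace PDMP

variable {E V : Type*} [MeasurableSpace E] [MeasurableSpace V] {lamV : Measure V}
  (Z : PDMP E V lamV) (r : EventRate E) (T : ℝ)

/-- The event rate of the exact process: `λ` along the flow. -/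
def exactRate : EventRate E where
  toFun z t := Z.lam (Z.flow t z)
  measurable_toFun := Z.measurable_lam.comp (Z.measurable_flow.comp measurable_swap)
  locally_integrable := Z.lam_locally_integrable

/-- For `x = (z, s)` with `z` the state just after the event at time `s` (or `s = 0`): the state
at time `t ≥ s` if no further event has occurred. -/
def drift (x : E × ℝ) (t : ℝ) : E := Z.flow (t - x.2) x.1

/-- The post-event state and the event time after the next event `(t, v)`. -/
def next (x : E × ℝ) (a : ℝ × V) : E × ℝ := (Z.xi (Z.drift x a.1) a.2, a.1)

/-- The density in `(t, v)` of the next event when the event rate is `r`: the event time is the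
first event before `T` of a Poisson process of rate `r` started at the last event, and the mark
`v` then has density `nu` at the pre-event state. -/
def eventDensity (x : E × ℝ) (a : ℝ × V) : ℝ≥0 :=
  r.toFun x.1 (a.1 - x.2) * r.survival x.1 (a.1 - x.2) * Z.nu (Z.drift x a.1) a.2

theorem measurable_drift : Measurable (Function.uncurry Z.drift) :=
  Z.measurable_flow.comp
    ((measurable_snd.sub (measurable_snd.comp measurable_fst)).prodMk
      (measurable_fst.comp measurable_fst))

theorem measurable_next : Measurable (Function.uncurry Z.next) := by
  have h1 : Measurable fun p : (E × ℝ) × (ℝ × V) => Z.drift p.1 p.2.1 :=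
    Z.measurable_drift.comp (measurable_fst.prodMk (measurable_fst.comp measurable_snd))
  exact (Z.measurable_xi.comp (h1.prodMk (measurable_snd.comp measurable_snd))).prodMk
    (measurable_fst.comp measurable_snd)

theorem measurable_eventDensity : Measurable (Function.uncurry (Z.eventDensity r)) := by
  have h1 : Measurable fun p : (E × ℝ) × (ℝ × V) => Z.drift p.1 p.2.1 :=
    Z.measurable_drift.comp (measurable_fst.prodMk (measurable_fst.comp measurable_snd))
  have h2 : Measurable fun p : (E × ℝ) × (ℝ × V) => (p.1.1, p.2.1 - p.1.2) := by fun_prop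
  exact ((r.measurable_toFun.comp h2).mul (r.measurable_survival.comp h2)).mul
    (Z.measurable_nu.comp (h1.prodMk (measurable_snd.comp measurable_snd)))

/-- One step of the simulation: the (sub-Markov) law of the next event before time `T`. -/
def eventKernel [SigmaFinite lamV] : Kernel (E × ℝ) (ℝ × V) :=
  (Kernel.const (E × ℝ) ((volume : Measure ℝ).prod lamV)).withDensity fun x a =>
    (({a | x.2 < a.1 ∧ a.1 < T}.indicator (Z.eventDensity r x) a : ℝ≥0) : ℝ≥0∞)

/-- Helper fact: the density in `eventKernel` is jointly measurable. -/
theorem measurable_eventKernel_density :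
    Measurable (Function.uncurry fun (x : E × ℝ) (a : ℝ × V) =>
      (({a | x.2 < a.1 ∧ a.1 < T}.indicator (Z.eventDensity r x) a : ℝ≥0) : ℝ≥0∞)) := by
  have hset : MeasurableSet {p : (E × ℝ) × (ℝ × V) | p.1.2 < p.2.1 ∧ p.2.1 < T} :=
    (measurableSet_lt (measurable_snd.comp measurable_fst)
      (measurable_fst.comp measurable_snd)).inter
        (measurableSet_lt (measurable_fst.comp measurable_snd) measurable_const)
  exact ((Z.measurable_eventDensity r).indicator hset).coe_nnreal_ennreal

/-- The sequential simulation, starting from `x = (z, s)`: `eventsLaw k x` is the law of the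
events in `(s, T)` on the event that there are exactly `k` of them. -/
def eventsLaw [SigmaFinite lamV] : (k : ℕ) → Kernel (E × ℝ) (Fin k → ℝ × V)
  | 0 => (Kernel.const (E × ℝ) (Measure.dirac Fin.elim0)).withDensity fun x _ =>
      (r.survival x.1 (T - x.2) : ℝ≥0∞)
  | k + 1 =>
      ((Z.eventKernel r T) ⊗ₖ ((eventsLaw k).comap (Function.uncurry Z.next)
        Z.measurable_next)).map fun p => (Fin.cons p.1 p.2 : Fin (k + 1) → ℝ × V)

/-- The law on skeletons of the process with event rate `r`, run from `z` up to time `T`. It has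
total mass one iff almost surely only finitely many events occur before `T`. -/
def skeletonLaw [SigmaFinite lamV] : Kernel E (Skeleton V T) :=
  (Kernel.sum fun k : ℕ => ((Z.eventsLaw r T k).comap (fun z : E => (z, (0 : ℝ)))
    (measurable_id.prodMk measurable_const)).map (ofEvents k)).comapRight
      (measurableEmbedding_skeleton T)

/-- The law of the path started from `z`. -/
def pathKernel [SigmaFinite lamV] : Kernel E (PathSpace E V T) :=
  Kernel.id ×ₖ Z.skeletonLaw r T

/-- The law on the path space of the process with initial law `m`. -/
def pathLaw [SigmaFinite lamV] (m : Measure E) : Measure (PathSpace E V T) :=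
  m ⊗ₘ Z.skeletonLaw r T

/-- Almost surely only finitely many events occur before time `T`, from every initial state. -/
def NonExplosive [SigmaFinite lamV] : Prop :=
  ∀ z, Z.skeletonLaw r T z Set.univ = 1

/-! #### Functionals of a path -/

/-- The pairs `(z_i, τ_i)`, `i = 0, …, k`, of post-event states and event times, with
`(z_0, τ_0) = x`. -/
def states : (k : ℕ) → E × ℝ → (Fin k → ℝ × V) → Fin (k + 1) → E × ℝ
  | 0, x, _ => fun _ => x
  | k + 1, x, e => Fin.cons x (states k (Z.next x (e 0)) (Fin.tail e))

/-- `(z_i, τ_i)` along a path, `i = 0, …, k`, with `τ_0 = 0`. -/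
def stateAt {T : ℝ} (w : PathSpace E V T) : Fin (w.2.1.1 + 1) → E × ℝ :=
  Z.states w.2.1.1 (w.1, 0) w.2.1.2

/-- The state just before event number `i + 1` along a path. -/
def preEvent {T : ℝ} (w : PathSpace E V T) (i : Fin w.2.1.1) : E :=
  Z.drift (Z.stateAt w i.castSucc) (w.2.1.2 i).1

/-- The state at time `T`. -/
def endState {T : ℝ} (w : PathSpace E V T) : E :=
  Z.drift (Z.stateAt w (Fin.last _)) T

/-- The density of the events `e = ((τ_1, v_1), …, (τ_k, v_k))` before time `T`, started from
`x = (z_0, τ_0)`, with event rate `r`: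
`exp (-∫₀^{T-τ_k} r z_k) ∏ᵢ r z_{i-1} (τ_i - τ_{i-1}) exp (-∫₀^{τ_i-τ_{i-1}} r z_{i-1}) ν(v_i)`,
with `ν` taken at the state just before the `i`-th event. -/
def eventsDensity (k : ℕ) (x : E × ℝ) (e : Fin k → ℝ × V) : ℝ≥0 :=
  r.survival (Z.states k x e (Fin.last k)).1 (T - (Z.states k x e (Fin.last k)).2) *
    ∏ i : Fin k, Z.eventDensity r (Z.states k x e i.castSucc) (e i)

/-- The conditional density of a path given its initial state, with event rate `r`. -/
def pathDensity {T : ℝ} (w : PathSpace E V T) : ℝ≥0 :=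
  Z.eventsDensity r T w.2.1.1 (w.1, 0) w.2.1.2

end PDMP

/-! ### Measurability of the path functionals -/

section Measurability

variable {E V : Type*} [MeasurableSpace E] [MeasurableSpace V] {lamV : Measure V}
  (Z : PDMP E V lamV) (r : EventRate E)

theorem measurable_of_sigma {X : Type*} [MeasurableSpace X]
    {f : E × (Σ k : ℕ, (Fin k → ℝ × V)) → X}
    (hf : ∀ k, Measurable fun p : E × (Fin k → ℝ × V) => f (p.1, ⟨k, p.2⟩)) :
    Measurable f := by
  intro s hs
  have : f ⁻¹' s = ⋃ k, Prod.map id (ofEvents k) ''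
      ((fun p : E × (Fin k → ℝ × V) => f (p.1, ⟨k, p.2⟩)) ⁻¹' s) := by
    ext ⟨z, k, e⟩
    simp only [Set.mem_preimage, Set.mem_iUnion, Set.mem_image]
    constructor
    · intro h
      exact ⟨k, (z, e), h, rfl⟩
    · rintro ⟨j, ⟨z', e'⟩, h, h'⟩
      rw [← h']
      exact h
  rw [this]
  exact MeasurableSet.iUnion fun k =>
    (MeasurableEmbedding.id.prodMap (measurableEmbedding_ofEvents k)).measurableSet_image' (hf k hs)

theorem PDMP.measurable_states (k : ℕ) (i : Fin (k + 1)) :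
    Measurable fun p : (E × ℝ) × (Fin k → ℝ × V) => Z.states k p.1 p.2 i := by
  induction k with
  | zero => exact measurable_fst
  | succ k ih =>
    refine Fin.cases ?_ (fun j => ?_) i
    · exact measurable_fst
    · have h0 : Measurable fun p : (E × ℝ) × (Fin (k + 1) → ℝ × V) =>
          (Z.next p.1 (p.2 0), Fin.tail p.2) := by
        refine (Z.measurable_next.comp (measurable_fst.prodMk
          ((measurable_pi_apply 0).comp measurable_snd))).prodMk ?_
        exact measurable_pi_lambda _ fun l => (measurable_pi_apply l.succ).comp measurable_snd
      exact (ih j).comp h0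

theorem PDMP.measurable_endState {T : ℝ} :
    Measurable (Z.endState : PathSpace E V T → E) := by
  have h : Measurable fun p : E × (Σ k : ℕ, (Fin k → ℝ × V)) =>
      Z.drift (Z.states p.2.1 (p.1, 0) p.2.2 (Fin.last _)) T := by
    refine measurable_of_sigma fun k => ?_
    exact Z.measurable_drift.comp (((Z.measurable_states k (Fin.last k)).comp
      ((measurable_fst.prodMk measurable_const).prodMk measurable_snd)).prodMk measurable_const)
  exact h.comp (measurable_fst.prodMk (measurable_subtype_coe.comp measurable_snd))

theorem PDMP.measurable_eventsDensity (T : ℝ) (k : ℕ) :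
    Measurable (Function.uncurry (Z.eventsDensity r T k)) := by
  have hs : ∀ i, Measurable fun p : (E × ℝ) × (Fin k → ℝ × V) => Z.states k p.1 p.2 i :=
    Z.measurable_states k
  have h1 : Measurable fun p : (E × ℝ) × (Fin k → ℝ × V) =>
      r.survival (Z.states k p.1 p.2 (Fin.last k)).1
        (T - (Z.states k p.1 p.2 (Fin.last k)).2) :=
    r.measurable_survival.comp ((measurable_fst.comp (hs _)).prodMk
      (measurable_const.sub (measurable_snd.comp (hs _))))
  have h2 : ∀ i : Fin k, Measurable fun p : (E × ℝ) × (Fin k → ℝ × V) =>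
      Z.eventDensity r (Z.states k p.1 p.2 i.castSucc) (p.2 i) := fun i =>
    (Z.measurable_eventDensity r).comp ((hs _).prodMk
      ((measurable_pi_apply i).comp measurable_snd))
  have h3 : Measurable fun p : (E × ℝ) × (Fin k → ℝ × V) =>
      ∏ i : Fin k, Z.eventDensity r (Z.states k p.1 p.2 i.castSucc) (p.2 i) :=
    Finset.measurable_fun_prod Finset.univ fun i _ => h2 i
  exact h1.mul h3

theorem PDMP.measurable_pathDensity {T : ℝ} :
    Measurable (Z.pathDensity r : PathSpace E V T → ℝ≥0) := by
  let g : E × (Σ k : ℕ, (Fin k → ℝ × V)) → ℝ≥0 :=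
    fun p => Function.uncurry (Z.eventsDensity r T p.2.1) ((p.1, 0), p.2.2)
  have hg : Measurable g := by
    refine measurable_of_sigma (f := g) fun k => ?_
    have hk : Measurable fun p : E × (Fin k → ℝ × V) => ((p.1, (0 : ℝ)), p.2) :=
      (measurable_fst.prodMk measurable_const).prodMk measurable_snd
    have := Measurable.comp (Z.measurable_eventsDensity r T k) hk
    exact this
  have hi : Measurable fun w : PathSpace E V T => (w.1, w.2.1) :=
    measurable_fst.prodMk (measurable_subtype_coe.comp measurable_snd)
  have := Measurable.comp hg hi
  exact this

end Measurability

/-! ### Reversal of paths, and the Metropolis-adjusted kernel -/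

section Metropolis

variable {E V Vr : Type*} [MeasurableSpace E] [MeasurableSpace V] [MeasurableSpace Vr]
  {lamV : Measure V} {lamVr : Measure Vr} {T : ℝ}

/-- `w'`, a path of the backward process `Zr`, is the path `w` of `Z` run backward in time: it
starts where `w` ends, it has events at the times `T - τ_i`, and its state just after the event
at time `T - τ_i` is the state of `w` just before time `τ_i`. (Event `i` of `w` counted from
zero corresponds to event `j` of `w'` with `i + j + 1 = k`.) -/
def IsReversal (Z : PDMP E V lamV) (Zr : PDMP E Vr lamVr)
    (w : PathSpace E V T) (w' : PathSpace E Vr T) : Prop :=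
  w'.1 = Z.endState w ∧ w'.2.1.1 = w.2.1.1 ∧
    ∀ (i : Fin w.2.1.1) (j : Fin w'.2.1.1), (i : ℕ) + j + 1 = w.2.1.1 →
      (w'.2.1.2 j).1 = T - (w.2.1.2 i).1 ∧ (Zr.stateAt w' j.succ).1 = Z.preEvent w i

/-- `Zr` is the time reversal on `[0, T]` of the exact process `Z` with initial law `m`: the
reversed path of `Z` has the law of a path of `Zr` with initial law `m`. -/
def IsTimeReversal [SigmaFinite lamV] [SigmaFinite lamVr] (Z : PDMP E V lamV)
    (Zr : PDMP E Vr lamVr) (m : Measure E) (R : PathSpace E V T ≃ᵐ PathSpace E Vr T) : Prop :=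
  (Z.pathLaw Z.exactRate T m).map R = Zr.pathLaw Zr.exactRate T m

/-- Acceptance probability of a forward path `w`:
`1 ∧ μ(w_T) p̃ʳ(R w | w_T) / (μ(w_0) p̃(w | w_0) ψ(R w))`. -/
def acceptForward (Z : PDMP E V lamV) (Zr : PDMP E Vr lamVr) (r rr : EventRate E)
    (mu : E → ℝ≥0) (R : PathSpace E V T ≃ᵐ PathSpace E Vr T) (psi : PathSpace E Vr T → ℝ≥0)
    (w : PathSpace E V T) : ℝ≥0∞ :=
  min 1 (((mu (Z.endState w) * Zr.pathDensity rr (R w) : ℝ≥0) : ℝ≥0∞) /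
    ((mu w.1 * Z.pathDensity r w * psi (R w) : ℝ≥0) : ℝ≥0∞))

/-- Acceptance probability of a backward path `w`:
`1 ∧ μ(w_T) p̃(R⁻¹ w | w_T) ψ(w) / (μ(w_0) p̃ʳ(w | w_0))`. -/
def acceptBackward (Z : PDMP E V lamV) (Zr : PDMP E Vr lamVr) (r rr : EventRate E)
    (mu : E → ℝ≥0) (R : PathSpace E V T ≃ᵐ PathSpace E Vr T) (psi : PathSpace E Vr T → ℝ≥0)
    (w : PathSpace E Vr T) : ℝ≥0∞ :=
  min 1 (((mu (Zr.endState w) * Z.pathDensity r (R.symm w) * psi w : ℝ≥0) : ℝ≥0∞) /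
    ((mu w.1 * Zr.pathDensity rr w : ℝ≥0) : ℝ≥0∞))

theorem measurable_acceptForward (Z : PDMP E V lamV) (Zr : PDMP E Vr lamVr) (r rr : EventRate E)
    {mu : E → ℝ≥0} (hmu : Measurable mu) (R : PathSpace E V T ≃ᵐ PathSpace E Vr T)
    {psi : PathSpace E Vr T → ℝ≥0} (hpsi : Measurable psi) :
    Measurable (acceptForward Z Zr r rr mu R psi) := by
  refine measurable_const.min (Measurable.div ?_ ?_)
  · exact ((hmu.comp Z.measurable_endState).mul
      ((Zr.measurable_pathDensity rr).comp R.measurable)).coe_nnreal_ennreal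
  · exact (((hmu.comp measurable_fst).mul (Z.measurable_pathDensity r)).mul
      (hpsi.comp R.measurable)).coe_nnreal_ennreal

theorem measurable_acceptBackward (Z : PDMP E V lamV) (Zr : PDMP E Vr lamVr)
    (r rr : EventRate E) {mu : E → ℝ≥0} (hmu : Measurable mu)
    (R : PathSpace E V T ≃ᵐ PathSpace E Vr T)
    {psi : PathSpace E Vr T → ℝ≥0} (hpsi : Measurable psi) :
    Measurable (acceptBackward Z Zr r rr mu R psi) := by
  refine measurable_const.min (Measurable.div ?_ ?_)
  · exact (((hmu.comp Zr.measurable_endState).mul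
      ((Z.measurable_pathDensity r).comp R.symm.measurable)).mul hpsi).coe_nnreal_ennreal
  · exact ((hmu.comp measurable_fst).mul (Zr.measurable_pathDensity rr)).coe_nnreal_ennreal

/-- Given a proposal `w`: move to `move w` with probability `alpha w`, otherwise to `stay w`. -/
def acceptReject {W S : Type*} [MeasurableSpace W] [MeasurableSpace S] (alpha : W → ℝ≥0∞)
    (halpha : Measurable alpha) (move stay : W → S) (hmove : Measurable move)
    (hstay : Measurable stay) : Kernel W S where
  toFun w := alpha w • Measure.dirac (move w) + (1 - alpha w) • Measure.dirac (stay w)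
  measurable' := by
    refine Measure.measurable_of_measurable_coe _ fun s hs => ?_
    simp only [Measure.add_apply, Measure.smul_apply, smul_eq_mul, Measure.dirac_apply' _ hs]
    exact (halpha.mul ((measurable_one.indicator hs).comp hmove)).add
      ((measurable_const.sub halpha).mul ((measurable_one.indicator hs).comp hstay))

theorem measurableSet_forward : MeasurableSet {p : E × ℤˣ | p.2 = 1} := by
  have h : Measurable fun p : E × ℤˣ => (p.2 : ℤ) :=
    (comap_measurable (Units.val : ℤˣ → ℤ)).comp measurable_snd
  have : {p : E × ℤˣ | p.2 = 1} = (fun p : E × ℤˣ => (p.2 : ℤ)) ⁻¹' {1} := by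
    ext p; simp
  rw [this]
  exact h (measurableSet_singleton 1)

open Classical in
/-- The Metropolis-adjusted PDMP kernel on `E × {-1, 1}`. From `(z, 1)`, sample a forward path
`w` with event rate `r` and go to `(w_T, -1)` with probability `acceptForward w`, otherwise stay
at `(z, 1)`. From `(z, -1)`, sample a backward path `w` with event rate `rr` and go to `(w_T, 1)`
with probability `acceptBackward w`, otherwise stay at `(z, -1)`. -/
def metropolisKernel [SigmaFinite lamV] [SigmaFinite lamVr] (Z : PDMP E V lamV)
    (Zr : PDMP E Vr lamVr) (r rr : EventRate E) (mu : E → ℝ≥0) (hmu : Measurable mu)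
    (R : PathSpace E V T ≃ᵐ PathSpace E Vr T) (psi : PathSpace E Vr T → ℝ≥0)
    (hpsi : Measurable psi) : Kernel (E × ℤˣ) (E × ℤˣ) :=
  Kernel.piecewise measurableSet_forward
    ((acceptReject (acceptForward Z Zr r rr mu R psi)
        (measurable_acceptForward Z Zr r rr hmu R hpsi)
        (fun w => (Z.endState w, -1)) (fun w => (w.1, 1))
        (Z.measurable_endState.prodMk measurable_const)
        (measurable_fst.prodMk measurable_const) ∘ₖ Z.pathKernel r T).comap
      Prod.fst measurable_fst)
    ((acceptReject (acceptBackward Z Zr r rr mu R psi)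
        (measurable_acceptBackward Z Zr r rr hmu R hpsi)
        (fun w => (Zr.endState w, 1)) (fun w => (w.1, -1))
        (Zr.measurable_endState.prodMk measurable_const)
        (measurable_fst.prodMk measurable_const) ∘ₖ Zr.pathKernel rr T).comap
      Prod.fst measurable_fst)

/-- The uniform probability measure on `{-1, 1}`. -/
def uniformSign : Measure ℤˣ :=
  (2⁻¹ : ℝ≥0∞) • (Measure.dirac 1 + Measure.dirac (-1))

end Metropolis

end PDMPSampler

end

/-!
A path of the process with event rate `r` is produced event by event, and the densities of the
successive events multiply. So, given its initial state, the path has density `pathDensity` with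
respect to the canonical measure on skeletons (`PDMP.skeletonLaw_eq_withDensity`), and with initial
density `μ` the law on path space is `μ(w_0) p(w | w_0) λ_W(dw)` (`PDMP.pathLaw_eq_withDensity`).

Detailed balance is then Metropolis-Hastings on path space with a deterministic involution. A
reversed path ends where the path started (`IsReversal.endState_eq`), and the change of variables
`R` carries `λ_W` to `ψ λ_{W^r}`. Multiplying the acceptance probability by the proposal density
clears its denominator, so accepted forward moves, transported by `R`, and accepted backward moves
both have the density
`min (μ(w_T) p(R⁻¹ w | w_T) ψ(w)) (μ(w_0) pʳ(w | w_0))`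
with respect to `λ_{W^r}` (`lintegral_acceptForward_eq`). Rejected moves stay put and are trivially
balanced.

If the processes are exact and the backward one is the time reversal of the forward one, the law of
the reversed forward path has both densities `μ(w_T) p(R⁻¹ w | w_T) ψ(w)` and `μ(w_0) pʳ(w | w_0)`,
which therefore agree almost everywhere (`ae_density_eq_of_isTimeReversal`). Then the acceptance
ratio is `1` wherever the path density is positive, hence almost surely.
-/

namespace PDMPSampler

/-! ### The path laws have densities -/

section Density

variable {E V : Type*} [MeasurableSpace E] [MeasurableSpace V] {lamV : Measure V}

/-- The events `e` occur at strictly increasing times in `(s, T)`. -/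
def IsEventSequence {V : Type*} {k : ℕ} (T s : ℝ) (e : Fin k → ℝ × V) : Prop :=
  (∀ i, (e i).1 ∈ Set.Ioo s T) ∧ ∀ i j, i < j → (e i).1 < (e j).1

theorem isEventSequence_cons {V : Type*} {k : ℕ} {T s : ℝ} (a : ℝ × V) (e : Fin k → ℝ × V) :
    IsEventSequence T s (Fin.cons a e : Fin (k + 1) → ℝ × V) ↔
      (s < a.1 ∧ a.1 < T) ∧ IsEventSequence T a.1 e := by
  simp only [IsEventSequence, Fin.forall_fin_succ, Fin.cons_zero, Fin.cons_succ, Set.mem_Ioo,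
    Fin.succ_lt_succ_iff, Fin.succ_pos, Fin.not_lt_zero, false_imp_iff,
    forall_true_left, true_and]
  constructor
  · rintro ⟨⟨h1, h2⟩, h3, h4⟩
    exact ⟨h1, fun i => ⟨h3 i, (h2 i).2⟩, h4⟩
  · rintro ⟨h1, h2, h3⟩
    exact ⟨⟨h1, fun i => ⟨h1.1.trans (h2 i).1, (h2 i).2⟩⟩, fun i => (h2 i).1, h3⟩

theorem measurableSet_isEventSequence (k : ℕ) (T : ℝ) :
    MeasurableSet {p : (E × ℝ) × (Fin k → ℝ × V) | IsEventSequence T p.1.2 p.2} := by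
  have h : ∀ i : Fin k, Measurable fun p : (E × ℝ) × (Fin k → ℝ × V) => (p.2 i).1 := fun i =>
    measurable_fst.comp ((measurable_pi_apply i).comp measurable_snd)
  have hs : Measurable fun p : (E × ℝ) × (Fin k → ℝ × V) => p.1.2 :=
    measurable_snd.comp measurable_fst
  have : {p : (E × ℝ) × (Fin k → ℝ × V) | IsEventSequence T p.1.2 p.2} =
      (⋂ i : Fin k, {p | p.1.2 < (p.2 i).1} ∩ {p | (p.2 i).1 < T}) ∩
        ⋂ i : Fin k, ⋂ j : Fin k, ⋂ _ : i < j, {p | (p.2 i).1 < (p.2 j).1} := by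
    ext p
    simp [IsEventSequence]
  rw [this]
  exact (MeasurableSet.iInter fun i =>
    (measurableSet_lt hs (h i)).inter (measurableSet_lt (h i) measurable_const)).inter
      (MeasurableSet.iInter fun i => MeasurableSet.iInter fun j => MeasurableSet.iInter fun _ =>
        measurableSet_lt (h i) (h j))

/-- Integration against a power of a measure, one coordinate at a time. -/
theorem lintegral_pi_succ {A : Type*} [MeasurableSpace A] (m : Measure A) [SigmaFinite m] (k : ℕ)
    {f : (Fin (k + 1) → A) → ℝ≥0∞} (hf : Measurable f) :
    ∫⁻ e, f e ∂(Measure.pi fun _ => m) =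
      ∫⁻ a, ∫⁻ e, f (Fin.cons a e) ∂(Measure.pi fun _ => m) ∂m := by
  have h := (measurePreserving_piFinSuccAbove (fun _ : Fin (k + 1) => m) 0).symm
  rw [← h.lintegral_comp hf, lintegral_prod]
  · simp [MeasurableEquiv.piFinSuccAbove_symm_apply, Fin.insertNthEquiv]
  · exact (hf.comp (MeasurableEquiv.measurable _)).aemeasurable

namespace PDMP

variable (Z : PDMP E V lamV) (r : EventRate E) (T : ℝ)

open Classical in
/-- The density `eventsDensity` of the events in `(x.2, T)`, extended by zero to those sequences of
`k` pairs whose times are not increasing in `(x.2, T)`. -/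
noncomputable def extendedDensity (k : ℕ) (x : E × ℝ) (e : Fin k → ℝ × V) : ℝ≥0∞ :=
  if IsEventSequence T x.2 e then (Z.eventsDensity r T k x e : ℝ≥0∞) else 0

theorem measurable_extendedDensity (k : ℕ) :
    Measurable (Function.uncurry (Z.extendedDensity r T k)) :=
  Measurable.ite (measurableSet_isEventSequence k T)
    (Z.measurable_eventsDensity r T k).coe_nnreal_ennreal measurable_const

theorem eventsDensity_cons (k : ℕ) (x : E × ℝ) (a : ℝ × V) (e : Fin k → ℝ × V) :
    Z.eventsDensity r T (k + 1) x (Fin.cons a e) =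
      Z.eventDensity r x a * Z.eventsDensity r T k (Z.next x a) e := by
  simp only [eventsDensity, states, Fin.prod_univ_succ, Fin.cons_zero, Fin.cons_succ,
    Fin.tail_cons, Fin.castSucc_zero, ← Fin.succ_castSucc, ← Fin.succ_last]
  ring

theorem extendedDensity_cons (k : ℕ) (x : E × ℝ) (a : ℝ × V) (e : Fin k → ℝ × V) :
    Z.extendedDensity r T (k + 1) x (Fin.cons a e) =
      (({a | x.2 < a.1 ∧ a.1 < T}.indicator (Z.eventDensity r x) a : ℝ≥0) : ℝ≥0∞) *
        Z.extendedDensity r T k (Z.next x a) e := by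
  classical
  simp only [extendedDensity, isEventSequence_cons, Set.indicator_apply, Set.mem_ofPred_eq,
    eventsDensity_cons]
  by_cases h1 : x.2 < a.1 ∧ a.1 < T <;> by_cases h2 : IsEventSequence T a.1 e <;>
    simp [h1, h2, next]

variable [SigmaFinite lamV]

instance : IsSFiniteKernel (Z.eventKernel r T) := by
  unfold eventKernel; infer_instance

instance (k : ℕ) : IsSFiniteKernel (Z.eventsLaw r T k) := by
  cases k <;> unfold eventsLaw <;> infer_instance

instance : IsSFiniteKernel (Z.skeletonLaw r T) := by
  unfold skeletonLaw; infer_instance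

instance : IsSFiniteKernel (Z.pathKernel r T) := by
  unfold pathKernel; infer_instance

/-- The law of the `k` events produced one after the other has the product density: by induction,
splitting off the first event and restarting from the state just after it. -/
theorem eventsLaw_eq_withDensity (k : ℕ) (x : E × ℝ) :
    Z.eventsLaw r T k x =
      (Measure.pi fun _ : Fin k => (volume : Measure ℝ).prod lamV).withDensity
        (Z.extendedDensity r T k x) := by
  induction k generalizing x with
  | zero =>
    have hm : Measurable (Function.uncurry fun (x : E × ℝ) (_ : Fin 0 → ℝ × V) =>
        (r.survival x.1 (T - x.2) : ℝ≥0∞)) :=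
      (r.measurable_survival.comp ((measurable_fst.comp measurable_fst).prodMk
        (measurable_const.sub (measurable_snd.comp measurable_fst)))).coe_nnreal_ennreal
    rw [eventsLaw, Kernel.withDensity_apply _ hm, Kernel.const_apply,
      Measure.pi_of_empty _ Fin.elim0]
    congr 1
    funext e
    simp [extendedDensity, IsEventSequence, eventsDensity, states]
  | succ k ih =>
    have hcons : Measurable fun p : (ℝ × V) × (Fin k → ℝ × V) =>
        (Fin.cons p.1 p.2 : Fin (k + 1) → ℝ × V) :=
      measurable_pi_lambda _ fun i => Fin.cases (by simpa using measurable_fst)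
        (fun j => by
          simpa [Function.comp_def] using (measurable_pi_apply j).comp measurable_snd) i
    have hD : ∀ k y, Measurable (Z.extendedDensity r T k y) := fun k y =>
      (Z.measurable_extendedDensity r T k).of_uncurry_left
    refine Measure.ext_of_lintegral _ fun f hf => ?_
    have hf' : ∀ a : ℝ × V, Measurable fun e : Fin k → ℝ × V =>
        f (Fin.cons a e : Fin (k + 1) → ℝ × V) := fun a =>
      hf.comp (hcons.comp measurable_prodMk_left)
    rw [eventsLaw, Kernel.lintegral_map _ hcons _ hf,
      Kernel.lintegral_compProd _ _ _ (f := fun p => f (Fin.cons p.1 p.2 : Fin (k + 1) → ℝ × V))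
        (hf.comp hcons), eventKernel,
      Kernel.lintegral_withDensity _ (Z.measurable_eventKernel_density r T),
      lintegral_withDensity_eq_lintegral_mul _ (hD _ _) hf,
      lintegral_pi_succ _ _ ((hD _ _).mul hf), Kernel.const_apply]
    · refine lintegral_congr fun a => ?_
      rw [Kernel.comap_apply, ih]
      simp only [Function.uncurry_apply_pair, Pi.mul_apply,
        extendedDensity_cons, mul_assoc]
      rw [lintegral_withDensity_eq_lintegral_mul _ (hD _ _) (hf' a),
        ← lintegral_const_mul _ ((hD _ _).mul (hf' a))]
      rfl
    · have := Measurable.lintegral_kernel_prod_right'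
        (κ := (Z.eventsLaw r T k).comap (Function.uncurry Z.next) Z.measurable_next)
        (f := fun p => f (Fin.cons p.1.2 p.2 : Fin (k + 1) → ℝ × V))
        (hf.comp (hcons.comp ((measurable_snd.comp measurable_fst).prodMk measurable_snd)))
      exact this.comp measurable_prodMk_left

end PDMP

instance (T : ℝ) [SigmaFinite lamV] : SFinite (skeletonMeasure lamV T) := by
  -- a comap along a measurable embedding is a kernel `comapRight`, for which s-finiteness is known
  let m : Measure (Σ k : ℕ, (Fin k → ℝ × V)) := Measure.sum fun k : ℕ =>
    (Measure.pi fun _ : Fin k => (volume : Measure ℝ).prod lamV).map (ofEvents k)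
  exact inferInstanceAs (SFinite ((Kernel.const Unit m).comapRight
    (measurableEmbedding_skeleton T) ()))

theorem PDMP.measurable_extendedDensity_sigma (Z : PDMP E V lamV) (r : EventRate E) (T : ℝ)
    (z : E) :
    Measurable fun s : Σ k : ℕ, (Fin k → ℝ × V) => Z.extendedDensity r T s.1 (z, 0) s.2 := by
  intro s hs
  exact measurableSet_sigma fun k =>
    (Z.measurable_extendedDensity r T k).of_uncurry_left (x := (z, 0)) hs

/-- The skeleton law from `z` has density `pathDensity (z, ·)`. -/
theorem PDMP.skeletonLaw_eq_withDensity [SigmaFinite lamV] (Z : PDMP E V lamV) (r : EventRate E)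
    (T : ℝ) (z : E) :
    Z.skeletonLaw r T z =
      (skeletonMeasure lamV T).withDensity fun s => (Z.pathDensity r (z, s) : ℝ≥0∞) := by
  have hD := Z.measurable_extendedDensity_sigma r T z
  -- the identity before restriction from all finite sequences to skeletons
  have key : (Measure.sum fun k => (Z.eventsLaw r T k (z, 0)).map (ofEvents k)) =
      (Measure.sum fun k : ℕ => (Measure.pi fun _ : Fin k =>
        (volume : Measure ℝ).prod lamV).map (ofEvents k)).withDensity
          fun s => Z.extendedDensity r T s.1 (z, 0) s.2 := by
    refine Measure.ext_of_lintegral _ fun f hf => ?_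
    rw [lintegral_withDensity_eq_lintegral_mul _ hD hf, lintegral_sum_measure,
      lintegral_sum_measure]
    refine tsum_congr fun k => ?_
    rw [lintegral_map hf (measurable_ofEvents k),
      lintegral_map (hD.mul hf) (measurable_ofEvents k), Z.eventsLaw_eq_withDensity,
      lintegral_withDensity_eq_lintegral_mul _
        (Z.measurable_extendedDensity r T k).of_uncurry_left (g := fun e => f (ofEvents k e))
        (hf.comp (measurable_ofEvents k))]
    rfl
  have hval := measurableEmbedding_skeleton (V := V) T
  ext s hs
  rw [skeletonLaw, Kernel.comapRight_apply, Kernel.sum_apply,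
    Measure.comap_apply _ hval.injective (fun s hs => hval.measurableSet_image.2 hs) _ hs]
  simp only [Kernel.map_apply _ (measurable_ofEvents _), Kernel.comap_apply]
  rw [key, withDensity_apply _ (hval.measurableSet_image.2 hs), withDensity_apply _ hs,
    skeletonMeasure]
  refine (setLIntegral_subtype (measurableSet_isSkeleton T) s _).symm.trans ?_
  exact lintegral_congr fun w => if_pos w.2

end Density

/-! ### Path laws from an initial density -/

section PathLaw

variable {E V : Type*} [MeasurableSpace E] [MeasurableSpace V] {lamV : Measure V}
  [SigmaFinite lamV] (Z : PDMP E V lamV) (r : EventRate E) {T : ℝ}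

/-- Started from the density `mu`, the path law has density `mu (w_0) p (w | w_0)`. -/
theorem PDMP.pathLaw_eq_withDensity (lamE : Measure E) [SigmaFinite lamE] {mu : E → ℝ≥0}
    (hmu : Measurable mu) :
    Z.pathLaw r T (lamE.withDensity fun z => (mu z : ℝ≥0∞)) =
      (pathMeasure lamE lamV T).withDensity
        fun w => ((mu w.1 * Z.pathDensity r w : ℝ≥0) : ℝ≥0∞) := by
  have hp := (Z.measurable_pathDensity r (T := T)).coe_nnreal_ennreal
  have hD : Measurable fun w : PathSpace E V T =>
      ((mu w.1 * Z.pathDensity r w : ℝ≥0) : ℝ≥0∞) :=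
    ((hmu.comp measurable_fst).mul (Z.measurable_pathDensity r)).coe_nnreal_ennreal
  refine Measure.ext_of_lintegral _ fun f hf => ?_
  rw [pathLaw, Measure.lintegral_compProd hf,
    lintegral_withDensity_eq_lintegral_mul _ hmu.coe_nnreal_ennreal
      hf.lintegral_kernel_prod_right',
    lintegral_withDensity_eq_lintegral_mul _ hD hf, pathMeasure,
    lintegral_prod _ (hD.mul hf).aemeasurable]
  refine lintegral_congr fun z => ?_
  have hz : Measurable fun s : Skeleton V T => (Z.pathDensity r (z, s) : ℝ≥0∞) :=
    hp.comp measurable_prodMk_left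
  have hfz : Measurable fun s : Skeleton V T => f (z, s) := hf.comp measurable_prodMk_left
  simp only [Pi.mul_apply]
  rw [Z.skeletonLaw_eq_withDensity, lintegral_withDensity_eq_lintegral_mul _ hz hfz,
    ← lintegral_const_mul _ (hz.mul hfz)]
  simp only [Pi.mul_apply, ENNReal.coe_mul, mul_assoc]

/-- Averaging over the initial state and then over the path is averaging over the path law. -/
theorem PDMP.lintegral_pathLaw (m : Measure E) [SFinite m] {g : E → ℝ≥0∞} (hg : Measurable g)
    {H : PathSpace E V T → ℝ≥0∞} (hH : Measurable H) :
    ∫⁻ w, g w.1 * H w ∂(Z.pathLaw r T m) = ∫⁻ z, g z * ∫⁻ w, H w ∂(Z.pathKernel r T z) ∂m := by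
  rw [pathLaw, Measure.lintegral_compProd (f := fun w => g w.1 * H w)
    ((hg.comp measurable_fst).mul hH)]
  refine lintegral_congr fun z => ?_
  dsimp only
  rw [pathKernel, Kernel.lintegral_id_prod hH, lintegral_const_mul _ (by fun_prop)]

theorem PDMP.isMarkovKernel_pathKernel {Z : PDMP E V lamV} {r : EventRate E}
    (h : Z.NonExplosive r T) : IsMarkovKernel (Z.pathKernel r T) := by
  have : IsMarkovKernel (Z.skeletonLaw r T) := ⟨fun z => ⟨h z⟩⟩
  unfold pathKernel
  infer_instance

theorem PDMP.isProbabilityMeasure_pathLaw {Z : PDMP E V lamV} {r : EventRate E}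
    (h : Z.NonExplosive r T) (m : Measure E) [IsProbabilityMeasure m] :
    IsProbabilityMeasure (Z.pathLaw r T m) := by
  have : IsMarkovKernel (Z.skeletonLaw r T) := ⟨fun z => ⟨h z⟩⟩
  unfold pathLaw
  infer_instance

end PathLaw

/-! ### Event times and dependence on the event rate -/

section EventTimes

variable {E V : Type*} [MeasurableSpace E] [MeasurableSpace V] {lamV : Measure V}
  (Z : PDMP E V lamV) {T : ℝ}

@[simp]
theorem PDMP.states_zero (k : ℕ) (x : E × ℝ) (e : Fin k → ℝ × V) : Z.states k x e 0 = x := by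
  cases k <;> simp [states]

theorem PDMP.states_succ_snd (k : ℕ) (x : E × ℝ) (e : Fin k → ℝ × V) (i : Fin k) :
    (Z.states k x e i.succ).2 = (e i).1 := by
  induction k generalizing x with
  | zero => exact i.elim0
  | succ k ih =>
    refine Fin.cases ?_ (fun j => ?_) i
    · simp [states, next]
    · simpa [states, Fin.tail] using ih _ (Fin.tail e) j

/-- The event preceding event number `i` occurs no later than it: waiting times are nonnegative. -/
theorem PDMP.states_castSucc_snd_le {k : ℕ} {s : ℝ} {x : E × ℝ} {e : Fin k → ℝ × V}
    (he : IsEventSequence T s e) (hx : x.2 = s) (i : Fin k) :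
    (Z.states k x e i.castSucc).2 ≤ (e i).1 := by
  cases k with
  | zero => exact i.elim0
  | succ k =>
    refine Fin.cases ?_ (fun j => ?_) i
    · simpa [hx] using (he.1 0).1.le
    · rw [← Fin.succ_castSucc, states_succ_snd]
      exact (he.2 _ _ Fin.castSucc_lt_succ).le

theorem PDMP.states_snd_mem {k : ℕ} {s : ℝ} {x : E × ℝ} {e : Fin k → ℝ × V}
    (he : IsEventSequence T s e) (hx : x.2 = s) (hs : s ≤ T) (i : Fin (k + 1)) :
    (Z.states k x e i).2 ∈ Set.Icc s T := by
  refine Fin.cases ?_ (fun j => ?_) i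
  · simp [hx, hs]
  · rw [states_succ_snd]
    exact ⟨(he.1 j).1.le, (he.1 j).2.le⟩

theorem EventRate.survival_congr {r r' : EventRate E}
    (h : ∀ z, ∀ t ∈ Set.Icc 0 T, r.toFun z t = r'.toFun z t) (z : E) {t : ℝ} (ht : t ≤ T) :
    r.survival z t = r'.survival z t := by
  unfold survival
  rw [setLIntegral_congr_fun measurableSet_Ioc fun u hu => ?_]
  rw [h z u ⟨hu.1.le, hu.2.trans ht⟩]

/-- The path density up to time `T` only involves the event rate at ages in `[0, T]`. -/
theorem PDMP.pathDensity_congr (hT : 0 ≤ T) {r r' : EventRate E}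
    (h : ∀ z, ∀ t ∈ Set.Icc 0 T, r.toFun z t = r'.toFun z t) (w : PathSpace E V T) :
    Z.pathDensity r w = Z.pathDensity r' w := by
  have hw : IsEventSequence T 0 w.2.1.2 := w.2.2
  have hm := fun i => Z.states_snd_mem hw (x := (w.1, 0)) rfl hT i
  unfold pathDensity eventsDensity
  congr 1
  · exact EventRate.survival_congr h _ (by linarith [(hm (Fin.last _)).1])
  · refine Finset.prod_congr rfl fun i _ => ?_
    have h1 := Z.states_castSucc_snd_le hw (x := (w.1, 0)) rfl i
    have h2 := (hm i.castSucc).1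
    have h3 := (hw.1 i).2
    unfold eventDensity
    rw [h _ _ ⟨by linarith, by linarith⟩, EventRate.survival_congr h _ (by linarith)]

end EventTimes

/-! ### Reversal of paths and the flux of accepted moves -/

section Reversal

variable {E V Vr : Type*} [MeasurableSpace E] [MeasurableSpace V] [MeasurableSpace Vr]
  {lamV : Measure V} {lamVr : Measure Vr} {T : ℝ}

/-- A reversed path ends where the path started: its last leg runs the flow back to time `0`. -/
theorem IsReversal.endState_eq {Z : PDMP E V lamV} {Zr : PDMP E Vr lamVr}
    (hflow : ∀ t z, Zr.flow t z = Z.flow (-t) z) {w : PathSpace E V T} {w' : PathSpace E Vr T}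
    (h : IsReversal Z Zr w w') : Zr.endState w' = w.1 := by
  obtain ⟨z, ⟨⟨k, e⟩, hs⟩⟩ := w
  obtain ⟨z', ⟨⟨k', e'⟩, hs'⟩⟩ := w'
  obtain ⟨h1, h2, h3⟩ := h
  have hback : ∀ t, Zr.flow t (Z.flow t z) = z := fun t => by
    rw [hflow, ← Z.flow_add, neg_add_cancel, Z.flow_zero]
  dsimp only at h1 h2 h3
  subst h2
  cases k' with
  | zero =>
    simp only [PDMP.endState, PDMP.stateAt, PDMP.states, PDMP.drift, sub_zero] at h1 ⊢
    rw [h1, hback]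
  | succ k =>
    -- the last event of the reversed path is the first event of the path
    obtain ⟨ht, hx⟩ := h3 0 (Fin.last k) (by simp)
    simp only [PDMP.endState, PDMP.stateAt, PDMP.preEvent, PDMP.drift, ← Fin.succ_last,
      Fin.castSucc_zero, PDMP.states_zero, PDMP.states_succ_snd, sub_zero] at ht hx ⊢
    rw [hx, ht, sub_sub_cancel, hback]

variable {lamE : Measure E} {Z : PDMP E V lamV} {Zr : PDMP E Vr lamVr} {r rr : EventRate E}
  {mu : E → ℝ≥0} {R : PathSpace E V T ≃ᵐ PathSpace E Vr T} {psi : PathSpace E Vr T → ℝ≥0}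

/-- Clearing the denominator of an acceptance probability. For `b = 0` both sides vanish,
whatever the convention for division by zero. -/
theorem mul_min_one_div (a b : ℝ≥0) :
    (b : ℝ≥0∞) * min 1 ((a : ℝ≥0∞) / b) = min (b : ℝ≥0∞) a := by
  rcases eq_or_ne b 0 with rfl | hb
  · simp
  · rw [mul_min, mul_one, ENNReal.mul_div_cancel (by simpa using hb) ENNReal.coe_ne_top]

/-- The forward and the backward moves carry the same flux: in path space both have density
`min (μ(w_T) p(R⁻¹ w | w_T) ψ(w)) (μ(w_0) pʳ(w | w_0))` with respect to the backward path
measure. -/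
theorem lintegral_acceptForward_eq [SigmaFinite lamE] [SigmaFinite lamV] [SigmaFinite lamVr]
    (hmu : Measurable mu) (hflow : ∀ t z, Zr.flow t z = Z.flow (-t) z)
    (hR : ∀ w, IsReversal Z Zr w (R w)) (hpsi : Measurable psi)
    (hvol : ∀ f : PathSpace E Vr T → ℝ≥0∞, Measurable f →
      ∫⁻ w, f (R w) ∂(pathMeasure lamE lamV T) =
        ∫⁻ w, f w * (psi w : ℝ≥0∞) ∂(pathMeasure lamE lamVr T))
    {G : E → E → ℝ≥0∞} (hG : Measurable (Function.uncurry G)) :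
    ∫⁻ w, G w.1 (Z.endState w) * acceptForward Z Zr r rr mu R psi w
        ∂(Z.pathLaw r T (lamE.withDensity fun z => (mu z : ℝ≥0∞))) =
      ∫⁻ w, G (Zr.endState w) w.1 * acceptBackward Z Zr r rr mu R psi w
        ∂(Zr.pathLaw rr T (lamE.withDensity fun z => (mu z : ℝ≥0∞))) := by
  have hGF : Measurable fun w : PathSpace E V T => G w.1 (Z.endState w) :=
    hG.comp (measurable_fst.prodMk Z.measurable_endState)
  have hGB : Measurable fun w : PathSpace E Vr T => G (Zr.endState w) w.1 :=
    hG.comp (Zr.measurable_endState.prodMk measurable_fst)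
  have hF : Measurable fun w => G w.1 (Z.endState w) * acceptForward Z Zr r rr mu R psi w :=
    hGF.mul (measurable_acceptForward Z Zr r rr hmu R hpsi)
  have hB : Measurable fun w => G (Zr.endState w) w.1 * acceptBackward Z Zr r rr mu R psi w :=
    hGB.mul (measurable_acceptBackward Z Zr r rr hmu R hpsi)
  have hDF : Measurable fun w : PathSpace E V T =>
      ((mu w.1 * Z.pathDensity r w : ℝ≥0) : ℝ≥0∞) :=
    ((hmu.comp measurable_fst).mul (Z.measurable_pathDensity r)).coe_nnreal_ennreal
  have hDB : Measurable fun w : PathSpace E Vr T =>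
      ((mu w.1 * Zr.pathDensity rr w : ℝ≥0) : ℝ≥0∞) :=
    ((hmu.comp measurable_fst).mul (Zr.measurable_pathDensity rr)).coe_nnreal_ennreal
  rw [Z.pathLaw_eq_withDensity r lamE hmu, Zr.pathLaw_eq_withDensity rr lamE hmu,
    lintegral_withDensity_eq_lintegral_mul _ hDF hF,
    lintegral_withDensity_eq_lintegral_mul _ hDB hB]
  -- the integrand pulled back to backward paths gains the factor `psi`, which completes the
  -- denominator of `acceptForward`
  have hv := hvol _ ((hDF.mul hF).comp R.symm.measurable)
  simp only [Function.comp_apply, MeasurableEquiv.symm_apply_apply] at hv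
  refine hv.trans (lintegral_congr fun w => ?_)
  obtain ⟨u, rfl⟩ := R.surjective w
  have h1 : Zr.endState (R u) = u.1 := (hR u).endState_eq hflow
  have h2 : (R u).1 = Z.endState u := (hR u).1
  simp only [Pi.mul_apply, MeasurableEquiv.symm_apply_apply, acceptForward, acceptBackward, h1, h2]
  have e1 := mul_min_one_div (mu (Z.endState u) * Zr.pathDensity rr (R u))
    (mu u.1 * Z.pathDensity r u * psi (R u))
  have e2 := mul_min_one_div (mu u.1 * Z.pathDensity r u * psi (R u))
    (mu (Z.endState u) * Zr.pathDensity rr (R u))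
  rw [min_comm (_ : ℝ≥0∞) ((mu u.1 * _ * _ : ℝ≥0) : ℝ≥0∞), ← e1] at e2
  calc _ = G u.1 (Z.endState u) * (((mu u.1 * Z.pathDensity r u * psi (R u) : ℝ≥0) : ℝ≥0∞) *
        min 1 (((mu (Z.endState u) * Zr.pathDensity rr (R u) : ℝ≥0) : ℝ≥0∞) /
          ((mu u.1 * Z.pathDensity r u * psi (R u) : ℝ≥0) : ℝ≥0∞))) := by
        rw [ENNReal.coe_mul (_ * _) (psi (R u))]; ring
    _ = _ := by rw [← e2]; ring

end Reversal

/-! ### Accept-reject steps -/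

section Metropolis

theorem acceptReject_apply {W S : Type*} [MeasurableSpace W] [MeasurableSpace S]
    {alpha : W → ℝ≥0∞} (halpha : Measurable alpha) {move stay : W → S} (hmove : Measurable move)
    (hstay : Measurable stay) (w : W) {s : Set S} (hs : MeasurableSet s) :
    acceptReject alpha halpha move stay hmove hstay w s =
      alpha w * s.indicator 1 (move w) + (1 - alpha w) * s.indicator 1 (stay w) := by
  change (alpha w • Measure.dirac (move w) + (1 - alpha w) • Measure.dirac (stay w)) s = _
  simp only [Measure.add_apply, Measure.smul_apply, smul_eq_mul, Measure.dirac_apply' _ hs]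

theorem isMarkovKernel_acceptReject {W S : Type*} [MeasurableSpace W] [MeasurableSpace S]
    {alpha : W → ℝ≥0∞} (halpha : Measurable alpha) {move stay : W → S} (hmove : Measurable move)
    (hstay : Measurable stay) (h : ∀ w, alpha w ≤ 1) :
    IsMarkovKernel (acceptReject alpha halpha move stay hmove hstay) :=
  ⟨fun w => ⟨by rw [acceptReject_apply _ _ _ _ .univ]; simpa using add_tsub_cancel_of_le (h w)⟩⟩

/-- The mass that an accept-reject step with proposals from the process `Z` carries from the set
`A` to the set `B`, split into accepted and rejected proposals. -/
theorem lintegral_acceptReject_comp {E V : Type*} [MeasurableSpace E] [MeasurableSpace V]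
    {lamV : Measure V} [SigmaFinite lamV] {T : ℝ} (Z : PDMP E V lamV) (r : EventRate E)
    (m : Measure E) [SFinite m]
    {alpha : PathSpace E V T → ℝ≥0∞} (halpha : Measurable alpha) (i j : ℤˣ)
    {A B : Set (E × ℤˣ)} (hA : MeasurableSet A) (hB : MeasurableSet B) :
    ∫⁻ z, A.indicator 1 (z, i) * (acceptReject alpha halpha (fun w => (Z.endState w, j))
        (fun w => (w.1, i)) (Z.measurable_endState.prodMk measurable_const)
        (measurable_fst.prodMk measurable_const) ∘ₖ Z.pathKernel r T) z B ∂m =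
      ∫⁻ w, A.indicator 1 (w.1, i) * B.indicator 1 (Z.endState w, j) * alpha w
          ∂(Z.pathLaw r T m) +
        ∫⁻ w, A.indicator 1 (w.1, i) * B.indicator 1 (w.1, i) * (1 - alpha w)
          ∂(Z.pathLaw r T m) := by
  have hA1 : Measurable fun z : E => A.indicator (1 : E × ℤˣ → ℝ≥0∞) (z, i) :=
    (measurable_one.indicator hA).comp measurable_prodMk_right
  have hB1 : Measurable fun z : E => B.indicator (1 : E × ℤˣ → ℝ≥0∞) (z, i) :=
    (measurable_one.indicator hB).comp measurable_prodMk_right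
  have hB2 : Measurable fun z : E => B.indicator (1 : E × ℤˣ → ℝ≥0∞) (z, j) :=
    (measurable_one.indicator hB).comp measurable_prodMk_right
  have hE : Measurable (Z.endState : PathSpace E V T → E) := Z.measurable_endState
  have hmv : Measurable fun w : PathSpace E V T =>
      A.indicator 1 (w.1, i) * B.indicator 1 (Z.endState w, j) * alpha w :=
    ((hA1.comp measurable_fst).mul (hB2.comp hE)).mul halpha
  rw [← lintegral_add_left hmv]
  simp only [Kernel.comp_apply' _ _ _ hB, acceptReject_apply _ _ _ _ hB]
  rw [← Z.lintegral_pathLaw r m hA1]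
  · refine lintegral_congr fun w => ?_
    ring
  · exact (halpha.mul (hB2.comp hE)).add
      ((measurable_const.sub halpha).mul (hB1.comp measurable_fst))

variable {E V Vr : Type*} [MeasurableSpace E] [MeasurableSpace V] [MeasurableSpace Vr]
  {lamV : Measure V} {lamVr : Measure Vr} {T : ℝ} {lamE : Measure E}
  {Z : PDMP E V lamV} {Zr : PDMP E Vr lamVr} {r rr : EventRate E}
  {mu : E → ℝ≥0} {R : PathSpace E V T ≃ᵐ PathSpace E Vr T} {psi : PathSpace E Vr T → ℝ≥0}

theorem lintegral_prod_uniformSign (m : Measure E) [SFinite m] {f : E × ℤˣ → ℝ≥0∞}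
    (hf : Measurable f) :
    ∫⁻ x, f x ∂(m.prod uniformSign) =
      2⁻¹ * (∫⁻ z, f (z, 1) ∂m + ∫⁻ z, f (z, -1) ∂m) := by
  have : SFinite uniformSign := by unfold uniformSign; infer_instance
  have h (z : E) : Measurable fun i => f (z, i) := hf.comp measurable_prodMk_left
  have h1 : Measurable fun z => f (z, 1) := hf.comp measurable_prodMk_right
  have h2 : Measurable fun z => f (z, -1) := hf.comp measurable_prodMk_right
  rw [lintegral_prod _ hf.aemeasurable, ← lintegral_add_left h1,
    ← lintegral_const_mul _ (by fun_prop)]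
  refine lintegral_congr fun z => ?_
  rw [uniformSign, lintegral_smul_measure, lintegral_add_measure, lintegral_dirac' _ (h z),
    lintegral_dirac' _ (h z), smul_eq_mul]

variable [SigmaFinite lamE] [SigmaFinite lamV] [SigmaFinite lamVr]

/-! ### Detailed balance -/

theorem isMarkovKernel_metropolisKernel (hr : Z.NonExplosive r T) (hrr : Zr.NonExplosive rr T)
    (hmu : Measurable mu) (hpsi : Measurable psi) :
    IsMarkovKernel (metropolisKernel Z Zr r rr mu hmu R psi hpsi) := by
  have := PDMP.isMarkovKernel_pathKernel hr
  have := PDMP.isMarkovKernel_pathKernel hrr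
  have := isMarkovKernel_acceptReject (measurable_acceptForward Z Zr r rr hmu R hpsi)
    (Z.measurable_endState.prodMk (measurable_const (a := (-1 : ℤˣ))))
    (measurable_fst.prodMk (measurable_const (a := (1 : ℤˣ)))) fun w => min_le_left _ _
  have := isMarkovKernel_acceptReject (measurable_acceptBackward Z Zr r rr hmu R hpsi)
    (Zr.measurable_endState.prodMk (measurable_const (a := (1 : ℤˣ))))
    (measurable_fst.prodMk (measurable_const (a := (-1 : ℤˣ)))) fun w => min_le_left _ _
  unfold metropolisKernel
  infer_instance

/-- Detailed balance: rejected proposals contribute symmetrically since they do not move, and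
accepted ones are matched by `lintegral_acceptForward_eq`. -/
theorem isReversible_metropolisKernel
    (hmu : Measurable mu) (hflow : ∀ t z, Zr.flow t z = Z.flow (-t) z)
    (hR : ∀ w, IsReversal Z Zr w (R w)) (hpsi : Measurable psi)
    (hvol : ∀ f : PathSpace E Vr T → ℝ≥0∞, Measurable f →
      ∫⁻ w, f (R w) ∂(pathMeasure lamE lamV T) =
        ∫⁻ w, f w * (psi w : ℝ≥0∞) ∂(pathMeasure lamE lamVr T)) :
    (metropolisKernel Z Zr r rr mu hmu R psi hpsi).IsReversible
      ((lamE.withDensity fun z => (mu z : ℝ≥0∞)).prod uniformSign) := by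
  set m := lamE.withDensity fun z => (mu z : ℝ≥0∞) with hm
  set K := metropolisKernel Z Zr r rr mu hmu R psi hpsi with hK
  -- the mass carried from `A` to `B`: accepted and rejected, forward and backward
  have flux {A B : Set (E × ℤˣ)} (hA : MeasurableSet A) (hB : MeasurableSet B) :
      ∫⁻ x in A, K x B ∂(m.prod uniformSign) = 2⁻¹ *
        ((∫⁻ w, A.indicator 1 (w.1, 1) * B.indicator 1 (Z.endState w, -1) *
            acceptForward Z Zr r rr mu R psi w ∂(Z.pathLaw r T m) +
          ∫⁻ w, A.indicator 1 (w.1, 1) * B.indicator 1 (w.1, 1) *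
            (1 - acceptForward Z Zr r rr mu R psi w) ∂(Z.pathLaw r T m)) +
        (∫⁻ w, A.indicator 1 (w.1, -1) * B.indicator 1 (Zr.endState w, 1) *
            acceptBackward Z Zr r rr mu R psi w ∂(Zr.pathLaw rr T m) +
          ∫⁻ w, A.indicator 1 (w.1, -1) * B.indicator 1 (w.1, -1) *
            (1 - acceptBackward Z Zr r rr mu R psi w) ∂(Zr.pathLaw rr T m))) := by
    have hi : (fun x => A.indicator (fun x => K x B) x) =
        fun x => A.indicator 1 x * K x B := by
      funext x
      by_cases hx : x ∈ A <;> simp [hx]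
    have hf : Measurable fun x => A.indicator 1 x * K x B :=
      (measurable_one.indicator hA).mul (K.measurable_coe hB)
    rw [← lintegral_indicator hA, hi, lintegral_prod_uniformSign m hf,
      ← lintegral_acceptReject_comp Z r m (measurable_acceptForward Z Zr r rr hmu R hpsi) 1 (-1)
        hA hB,
      ← lintegral_acceptReject_comp Zr rr m (measurable_acceptBackward Z Zr r rr hmu R hpsi)
        (-1) 1 hA hB]
    have h1 (z : E) : (z, (1 : ℤˣ)) ∈ {p : E × ℤˣ | p.2 = 1} := rfl
    have h2 (z : E) : (z, (-1 : ℤˣ)) ∉ {p : E × ℤˣ | p.2 = 1} := fun h => by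
      have : (-1 : ℤˣ) = 1 := h
      exact absurd this (by decide)
    simp only [hK, metropolisKernel, Kernel.piecewise_apply, h1, h2, if_true, if_false,
      Kernel.comap_apply]
  have hind {A : Set (E × ℤˣ)} (hA : MeasurableSet A) (i : ℤˣ) :
      Measurable fun z : E => A.indicator (1 : E × ℤˣ → ℝ≥0∞) (z, i) :=
    (measurable_one.indicator hA).comp measurable_prodMk_right
  -- an accepted forward move from `A` to `B` is an accepted backward move from `B` to `A`
  have swap {A B : Set (E × ℤˣ)} (hA : MeasurableSet A) (hB : MeasurableSet B) :
      ∫⁻ w, A.indicator 1 (w.1, 1) * B.indicator 1 (Z.endState w, -1) *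
          acceptForward Z Zr r rr mu R psi w ∂(Z.pathLaw r T m) =
        ∫⁻ w, B.indicator 1 (w.1, -1) * A.indicator 1 (Zr.endState w, 1) *
          acceptBackward Z Zr r rr mu R psi w ∂(Zr.pathLaw rr T m) := by
    have := lintegral_acceptForward_eq (r := r) (rr := rr) hmu hflow hR hpsi hvol
      (G := fun y z => A.indicator 1 (y, 1) * B.indicator 1 (z, -1))
      (((hind hA 1).comp measurable_fst).mul ((hind hB (-1)).comp measurable_snd))
    simpa only [mul_comm (A.indicator _ (Zr.endState _, _))] using this
  intro A B hA hB
  rw [flux hA hB, flux hB hA, swap hA hB, swap hB hA]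
  simp only [mul_comm (B.indicator _ (Prod.fst _, _)) (A.indicator _ (Prod.fst _, _))]
  ring

/-! ### Acceptance probability one for exact processes -/

/-- For the exact processes the two path densities correspond under reversal, since both express
the law of the backward path. -/
theorem ae_density_eq_of_isTimeReversal (hT : 0 ≤ T) (hmu : Measurable mu)
    (hmu_one : ∫⁻ z, (mu z : ℝ≥0∞) ∂lamE = 1) (hr : Z.NonExplosive r T) (hpsi : Measurable psi)
    (hvol : ∀ f : PathSpace E Vr T → ℝ≥0∞, Measurable f →
      ∫⁻ w, f (R w) ∂(pathMeasure lamE lamV T) =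
        ∫⁻ w, f w * (psi w : ℝ≥0∞) ∂(pathMeasure lamE lamVr T))
    (hex : ∀ z, ∀ t ∈ Set.Icc 0 T, r.toFun z t = Z.lam (Z.flow t z))
    (hexr : ∀ z, ∀ t ∈ Set.Icc 0 T, rr.toFun z t = Zr.lam (Zr.flow t z))
    (hrev : IsTimeReversal Z Zr (lamE.withDensity fun z => (mu z : ℝ≥0∞)) R) :
    ∀ᵐ w ∂(pathMeasure lamE lamVr T),
      mu (R.symm w).1 * Z.pathDensity r (R.symm w) * psi w = mu w.1 * Zr.pathDensity rr w := by
  set m := lamE.withDensity fun z => (mu z : ℝ≥0∞) with hm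
  have : IsProbabilityMeasure m :=
    ⟨by rw [hm, withDensity_apply _ .univ, Measure.restrict_univ, hmu_one]⟩
  have := PDMP.isProbabilityMeasure_pathLaw hr m
  have hD : Measurable fun w : PathSpace E V T => mu w.1 * Z.pathDensity r w :=
    (hmu.comp measurable_fst).mul (Z.measurable_pathDensity r)
  have hDr : Measurable fun w : PathSpace E Vr T => mu w.1 * Zr.pathDensity rr w :=
    (hmu.comp measurable_fst).mul (Zr.measurable_pathDensity rr)
  have hDpsi : Measurable fun w : PathSpace E Vr T =>
      mu (R.symm w).1 * Z.pathDensity r (R.symm w) * psi w :=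
    (hD.comp R.symm.measurable).mul hpsi
  have hF : Z.pathLaw Z.exactRate T m = Z.pathLaw r T m := by
    rw [hm, Z.pathLaw_eq_withDensity _ lamE hmu, Z.pathLaw_eq_withDensity _ lamE hmu]
    simp only [Z.pathDensity_congr hT (r := r) (r' := Z.exactRate) hex]
  have hB : Zr.pathLaw Zr.exactRate T m = Zr.pathLaw rr T m := by
    rw [hm, Zr.pathLaw_eq_withDensity _ lamE hmu, Zr.pathLaw_eq_withDensity _ lamE hmu]
    simp only [Zr.pathDensity_congr hT (r := rr) (r' := Zr.exactRate) hexr]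
  rw [IsTimeReversal, hF, hB] at hrev
  -- change of variables: the density of the reversed forward path
  have hmap : (Z.pathLaw r T m).map R = (pathMeasure lamE lamVr T).withDensity fun w =>
      ((mu (R.symm w).1 * Z.pathDensity r (R.symm w) * psi w : ℝ≥0) : ℝ≥0∞) := by
    refine Measure.ext_of_lintegral _ fun f hf => ?_
    have hfR : Measurable fun w => f (R w) := hf.comp R.measurable
    rw [lintegral_map hf R.measurable, hm, Z.pathLaw_eq_withDensity r lamE hmu,
      lintegral_withDensity_eq_lintegral_mul _ hD.coe_nnreal_ennreal hfR,
      lintegral_withDensity_eq_lintegral_mul _ hDpsi.coe_nnreal_ennreal hf]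
    have hv := hvol _ ((hD.coe_nnreal_ennreal.comp R.symm.measurable).mul hf)
    simp only [Pi.mul_apply, Function.comp_apply, MeasurableEquiv.symm_apply_apply] at hv
    refine hv.trans (lintegral_congr fun w => ?_)
    simp only [Pi.mul_apply, ENNReal.coe_mul]
    ring
  have hfin : ∫⁻ w, ((mu (R.symm w).1 * Z.pathDensity r (R.symm w) * psi w : ℝ≥0) : ℝ≥0∞)
      ∂(pathMeasure lamE lamVr T) ≠ ∞ := by
    rw [← setLIntegral_univ, ← withDensity_apply _ .univ, ← hmap]
    exact (measure_lt_top ((Z.pathLaw r T m).map R) _).ne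
  rw [hmap, hm, Zr.pathLaw_eq_withDensity rr lamE hmu,
    withDensity_eq_iff hDpsi.coe_nnreal_ennreal.aemeasurable
      hDr.coe_nnreal_ennreal.aemeasurable hfin] at hrev
  filter_upwards [hrev] with w hw
  exact_mod_cast hw

omit [SigmaFinite lamE] [SigmaFinite lamV] [SigmaFinite lamVr] in
/-- Properties that hold almost everywhere on backward paths pull back along the reversal; the
set where `psi` vanishes has a null preimage, so nothing is asked there. -/
theorem ae_comp_reversal (hvol : ∀ f : PathSpace E Vr T → ℝ≥0∞, Measurable f →
      ∫⁻ w, f (R w) ∂(pathMeasure lamE lamV T) =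
        ∫⁻ w, f w * (psi w : ℝ≥0∞) ∂(pathMeasure lamE lamVr T))
    {p : PathSpace E Vr T → Prop} (hp : MeasurableSet {w | p w})
    (h : ∀ᵐ w ∂(pathMeasure lamE lamVr T), psi w ≠ 0 → p w) :
    ∀ᵐ w ∂(pathMeasure lamE lamV T), p (R w) := by
  have hm : Measurable fun w => {w | p w}ᶜ.indicator (1 : PathSpace E Vr T → ℝ≥0∞) (R w) :=
    (measurable_one.indicator hp.compl).comp R.measurable
  have hv := hvol _ (measurable_one.indicator hp.compl)
  have h0 : ∫⁻ w, {w | p w}ᶜ.indicator 1 w * (psi w : ℝ≥0∞) ∂(pathMeasure lamE lamVr T) = 0 := by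
    rw [lintegral_eq_zero_of_ae_eq_zero]
    filter_upwards [h] with w hw
    by_cases hpw : p w
    · simp [hpw]
    · simp [not_not.1 (mt hw hpw)]
  rw [h0, lintegral_eq_zero_iff hm] at hv
  filter_upwards [hv] with w hw
  simpa using hw

omit [SigmaFinite lamV] in
/-- Numerator and denominator agree almost everywhere, and the denominator, being the density of
the path law, is almost surely nonzero. -/
theorem ae_acceptBackward_eq_one (hmu : Measurable mu) (hflow : ∀ t z, Zr.flow t z = Z.flow (-t) z)
    (hR : ∀ w, IsReversal Z Zr w (R w))
    (h : ∀ᵐ w ∂(pathMeasure lamE lamVr T),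
      mu (R.symm w).1 * Z.pathDensity r (R.symm w) * psi w = mu w.1 * Zr.pathDensity rr w) :
    ∀ᵐ w ∂(Zr.pathLaw rr T (lamE.withDensity fun z => (mu z : ℝ≥0∞))),
      acceptBackward Z Zr r rr mu R psi w = 1 := by
  have hDr : Measurable fun w : PathSpace E Vr T => mu w.1 * Zr.pathDensity rr w :=
    (hmu.comp measurable_fst).mul (Zr.measurable_pathDensity rr)
  rw [Zr.pathLaw_eq_withDensity rr lamE hmu, ae_withDensity_iff hDr.coe_nnreal_ennreal]
  filter_upwards [h] with w hw hne
  have he : Zr.endState w = (R.symm w).1 := by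
    have := (hR (R.symm w)).endState_eq hflow
    rwa [R.apply_symm_apply] at this
  rw [acceptBackward, he, hw, ENNReal.div_self hne ENNReal.coe_ne_top, min_self]

omit [SigmaFinite lamVr] in
/-- The ratio in `acceptForward` has denominator `psi (R w)` times the density of the path
law: that density is almost surely nonzero, and `psi ∘ R` is almost everywhere nonzero. -/
theorem ae_acceptForward_eq_one (hmu : Measurable mu) (hR : ∀ w, IsReversal Z Zr w (R w))
    (hpsi : Measurable psi)
    (hvol : ∀ f : PathSpace E Vr T → ℝ≥0∞, Measurable f →
      ∫⁻ w, f (R w) ∂(pathMeasure lamE lamV T) =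
        ∫⁻ w, f w * (psi w : ℝ≥0∞) ∂(pathMeasure lamE lamVr T))
    (h : ∀ᵐ w ∂(pathMeasure lamE lamVr T),
      mu (R.symm w).1 * Z.pathDensity r (R.symm w) * psi w = mu w.1 * Zr.pathDensity rr w) :
    ∀ᵐ w ∂(Z.pathLaw r T (lamE.withDensity fun z => (mu z : ℝ≥0∞))),
      acceptForward Z Zr r rr mu R psi w = 1 := by
  have hD : Measurable fun w : PathSpace E V T => mu w.1 * Z.pathDensity r w :=
    (hmu.comp measurable_fst).mul (Z.measurable_pathDensity r)
  have hDr : Measurable fun w : PathSpace E Vr T => mu w.1 * Zr.pathDensity rr w :=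
    (hmu.comp measurable_fst).mul (Zr.measurable_pathDensity rr)
  have h' := ae_comp_reversal hvol
    (measurableSet_eq_fun ((hD.comp R.symm.measurable).mul hpsi) hDr)
    (h.mono fun w hw _ => hw)
  have hpos := ae_comp_reversal hvol (p := fun w => psi w ≠ 0)
    (hpsi (measurableSet_singleton 0)).compl (Filter.Eventually.of_forall fun _ h => h)
  rw [Z.pathLaw_eq_withDensity r lamE hmu, ae_withDensity_iff hD.coe_nnreal_ennreal]
  filter_upwards [h', hpos] with w hw hne hne'
  simp only [Function.comp_apply, Pi.mul_apply, MeasurableEquiv.symm_apply_apply] at hw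
  rw [acceptForward, ← (hR w).1, hw, ENNReal.div_self _ ENNReal.coe_ne_top, min_self]
  rw [← hw]
  exact_mod_cast mul_ne_zero (by exact_mod_cast hne') hne

end Metropolis
end PDMPSampler

theorem mainTheorem1 {E V Vr : Type*} [MeasurableSpace E] [MeasurableSpace V]
    [MeasurableSpace Vr] (lamE : Measure E) [SigmaFinite lamE]
    (lamV : Measure V) [SigmaFinite lamV] (lamVr : Measure Vr) [SigmaFinite lamVr]
    (T : ℝ) (hT : 0 < T)
    -- the target density
    (mu : E → ℝ≥0) (hmu : Measurable mu) (hmu_one : ∫⁻ z, (mu z : ℝ≥0∞) ∂lamE = 1)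
    -- the forward characteristics, the backward ones, and the approximate event rates
    (Z : PDMPSampler.PDMP E V lamV) (Zr : PDMPSampler.PDMP E Vr lamVr)
    (hflow : ∀ t z, Zr.flow t z = Z.flow (-t) z)
    (r rr : PDMPSampler.EventRate E)
    (hr : Z.NonExplosive r T) (hrr : Zr.NonExplosive rr T)
    -- the reversal of paths and its volume change
    (R : PDMPSampler.PathSpace E V T ≃ᵐ PDMPSampler.PathSpace E Vr T)
    (hR : ∀ w, PDMPSampler.IsReversal Z Zr w (R w))
    (psi : PDMPSampler.PathSpace E Vr T → ℝ≥0) (hpsi : Measurable psi)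
    (hvol : ∀ f : PDMPSampler.PathSpace E Vr T → ℝ≥0∞, Measurable f →
      ∫⁻ w, f (R w) ∂(PDMPSampler.pathMeasure lamE lamV T) =
        ∫⁻ w, f w * (psi w : ℝ≥0∞) ∂(PDMPSampler.pathMeasure lamE lamVr T)) :
    IsMarkovKernel (PDMPSampler.metropolisKernel Z Zr r rr mu hmu R psi hpsi) ∧
    (PDMPSampler.metropolisKernel Z Zr r rr mu hmu R psi hpsi).IsReversible
      ((lamE.withDensity fun z => (mu z : ℝ≥0∞)).prod PDMPSampler.uniformSign) ∧
    ((∀ z, ∀ t ∈ Set.Icc 0 T, r.toFun z t = Z.lam (Z.flow t z)) →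
      (∀ z, ∀ t ∈ Set.Icc 0 T, rr.toFun z t = Zr.lam (Zr.flow t z)) →
      PDMPSampler.IsTimeReversal Z Zr (lamE.withDensity fun z => (mu z : ℝ≥0∞)) R →
      (∀ᵐ w ∂(Z.pathLaw r T (lamE.withDensity fun z => (mu z : ℝ≥0∞))),
        PDMPSampler.acceptForward Z Zr r rr mu R psi w = 1) ∧
      (∀ᵐ w ∂(Zr.pathLaw rr T (lamE.withDensity fun z => (mu z : ℝ≥0∞))),
        PDMPSampler.acceptBackward Z Zr r rr mu R psi w = 1)) := by
  have hdens := fun h1 h2 h3 => PDMPSampler.ae_density_eq_of_isTimeReversal (Z := Z) (Zr := Zr)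
    (r := r) (rr := rr) hT.le hmu hmu_one hr hpsi hvol h1 h2 h3
  exact ⟨PDMPSampler.isMarkovKernel_metropolisKernel hr hrr hmu hpsi,
    PDMPSampler.isReversible_metropolisKernel hmu hflow hR hpsi hvol, fun h1 h2 h3 =>
      ⟨PDMPSampler.ae_acceptForward_eq_one hmu hR hpsi hvol (hdens h1 h2 h3),
        PDMPSampler.ae_acceptBackward_eq_one hmu hflow hR (hdens h1 h2 h3)⟩⟩
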